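/- Consider the Cramér–Lundberg model with premium rate $p$, claim intensity $\beta>0$, discount rate $q>0$ and maximal dividend rate $\overline c$. The free surplus is $$X_t=x+pt-\sum_{i=1}^{N_t}U_i ,\qquad t\ge 0,$$ where $(N_t)$ is a Poisson process with intensity $\beta$ (that is, the interarrival times of the claims are i.i.d. exponential with parameter $\beta$), independent of the claim sizes $U_i\ge 0$, which are i.i.d. with finite mean, with distribution function $F$, and satisfy the safety loading condition $p>\beta\,\mathbb E[U_i]$. Assume that $F$ is globally Lipschitz: there is $K>0$ with $0\le F(y)-F(x)\le K(y-x)$ for all $x<y$. Let $(\mathcal F_t)_{t\ge0}$ be the filtration generated by $(X_t)$, completed by the null sets. For $x\ge 0$ and $c\in[0,\overline c]$ let $\Pi_{x,c,\overline c}$ be the set of admissible dividend ratcheting strategies, i.e. of all processes $C=(C_t)_{t\ge 0}$ that are $(\mathcal F_t)$-adapted, càdlàg, non-decreasing and satisfy $c\le C_t\le\overline c$ for all $t\ge 0$. Put $X^C_t=X_t-\int_0^tC_s\,ds$, let $\tau=\inf\{t\ge 0: X^C_t<0\}$ be the ruin time, and set $$J(x;C)=\mathbb E\Big[\int_0^{\tau}e^{-qs}C_s\,ds\Big],\qquad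 V(x,c)=\sup_{C\in\Pi_{x,c,\overline c}}J(x;C).$$ **Proposition.** If $\overline c>p$, then there exist constants $K_2>0$ and $K_3>0$ (depending only on $p,\beta,q,\overline c$ and $F$) such that $$0\le V(x_2,c_1)-V(x_1,c_2)\le\Big[K_2+\frac{K_3}{c_1-p}\Big](x_2-x_1)+\Big[K_2+\frac{K_3\,x_2}{(c_1-p)^2}\Big](c_2-c_1)$$ for all $0\le x_1\le x_2$ and $p<c_1\le c_2\le\overline c$. -/

import Mathlib

open MeasureTheory ProbabilityTheory Filter Topology Set

namespace Ratcheting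

noncomputable section

/-- The arrival time of the `n`-th claim (claims are numbered from `0`), as the sum of the first
`n + 1` interarrival times. -/
def arrivalTime {Ω : Type*} (W : ℕ → Ω → ℝ) (n : ℕ) (ω : Ω) : ℝ :=
  ∑ k ∈ Finset.range (n + 1), W k ω

/-- The number `N_t` of claims that have arrived up to time `t`. -/
def claimCount {Ω : Type*} (W : ℕ → Ω → ℝ) (t : ℝ) (ω : Ω) : ℕ :=
  Set.ncard {n : ℕ | arrivalTime W n ω ≤ t}

/-- The free surplus `X_t = x + p t - ∑_{i ≤ N_t} U_i`. -/
def surplus {Ω : Type*} (x p : ℝ) (W U : ℕ → Ω → ℝ) (t : ℝ) (ω : Ω) : ℝ :=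
  x + p * t - ∑ i ∈ Finset.range (claimCount W t ω), U i ω

/-- The probabilistic assumptions of the Cramér-Lundberg model with claim intensity `β` and claim
size law `ν`: the claim sizes `U` are i.i.d. with law `ν`, the interarrival times `W` are i.i.d.
exponential with parameter `β` (so that the claim counting process is a Poisson process with
intensity `β`), and the two families are independent of each other. -/
structure IsCramerLundberg {Ω : Type*} [MeasurableSpace Ω] (μ : Measure Ω) (β : ℝ)
    (ν : Measure ℝ) (W U : ℕ → Ω → ℝ) : Prop where
  measurable_interarrival : ∀ n, Measurable (W n)
  measurable_claim : ∀ n, Measurable (U n)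
  map_interarrival : ∀ n, μ.map (W n) = expMeasure β
  map_claim : ∀ n, μ.map (U n) = ν
  indep : iIndepFun (fun i : ℕ ⊕ ℕ => Sum.elim W U i) μ

/-- The filtration generated by the free surplus process, completed by the null sets: an event
belongs to the `σ`-algebra at time `t` if it agrees up to a null set with an event that is
generated by `(X_s)_{0 ≤ s ≤ t}`. -/
def surplusFiltration {Ω : Type*} [m : MeasurableSpace Ω] (μ : Measure Ω) (x p : ℝ)
    (W U : ℕ → Ω → ℝ) : Filtration ℝ m where
  seq t := eventuallyMeasurableSpace
    (⨆ s ∈ Set.Icc (0 : ℝ) t, MeasurableSpace.comap (surplus x p W U s) inferInstance) (ae μ) ⊓ m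
  mono' := by
    intro s t hst
    refine inf_le_inf_right m ?_
    rintro A ⟨B, hB, hAB⟩
    refine ⟨B, ?_, hAB⟩
    exact (biSup_mono fun r hr => Set.Icc_subset_Icc_right hst hr :
      (⨆ r ∈ Set.Icc (0 : ℝ) s, MeasurableSpace.comap (surplus x p W U r) inferInstance) ≤
        ⨆ r ∈ Set.Icc (0 : ℝ) t, MeasurableSpace.comap (surplus x p W U r) inferInstance) B hB
  le' _ := inf_le_right

/-- The set `Π_{x,c,cbar}` of admissible dividend ratcheting strategies. A strategy is a process
`C` of which only the values at times `t ≥ 0` matter: it is adapted, càdlàg, non-decreasing, and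
takes values in `[c, cbar]`. -/
structure IsAdmissible {Ω : Type*} [MeasurableSpace Ω] (μ : Measure Ω) (p cbar : ℝ)
    (W U : ℕ → Ω → ℝ) (x c : ℝ) (C : ℝ → Ω → ℝ) : Prop where
  adapted : ∀ t, 0 ≤ t → Measurable[surplusFiltration μ x p W U t] (C t)
  right_continuous : ∀ ω t, 0 ≤ t → ContinuousWithinAt (fun s => C s ω) (Set.Ici t) t
  left_limits : ∀ ω t, 0 < t → ∃ l, Tendsto (fun s => C s ω) (𝓝[<] t) (𝓝 l)
  monotone : ∀ ω, MonotoneOn (fun s => C s ω) (Set.Ici 0)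
  mem_Icc : ∀ ω t, 0 ≤ t → C t ω ∈ Set.Icc c cbar

/-- The controlled surplus `X_t^C = X_t - ∫_0^t C_s ds`. -/
def controlledSurplus {Ω : Type*} (x p : ℝ) (W U : ℕ → Ω → ℝ) (C : ℝ → Ω → ℝ) (t : ℝ) (ω : Ω) :
    ℝ :=
  surplus x p W U t ω - ∫ s in (0 : ℝ)..t, C s ω

/-- The ruin time `inf {t ≥ 0 : X_t^C < 0}`, equal to `∞` if ruin never occurs. -/
def ruinTime {Ω : Type*} (x p : ℝ) (W U : ℕ → Ω → ℝ) (C : ℝ → Ω → ℝ) (ω : Ω) : EReal :=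
  sInf ((fun t : ℝ => (t : EReal)) '' {t : ℝ | 0 ≤ t ∧ controlledSurplus x p W U C t ω < 0})

/-- The value `J(x; C) = E[∫_0^τ e^{-qs} C_s ds]` of the strategy `C`, where `τ` is the ruin time;
the integrand is nonnegative, so that this is an integral with values in `[0, ∞]`. -/
def strategyValue {Ω : Type*} [MeasurableSpace Ω] (μ : Measure Ω) (p q : ℝ) (W U : ℕ → Ω → ℝ)
    (x : ℝ) (C : ℝ → Ω → ℝ) : ENNReal :=
  ∫⁻ ω, (∫⁻ s in {s : ℝ | 0 ≤ s ∧ (s : EReal) < ruinTime x p W U C ω},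
    ENNReal.ofReal (Real.exp (-q * s) * C s ω)) ∂μ

/-- The supremum of the values of all admissible strategies, as an element of `[0, ∞]`. -/
def optimalValueENNReal {Ω : Type*} [MeasurableSpace Ω] (μ : Measure Ω) (p q cbar : ℝ)
    (W U : ℕ → Ω → ℝ) (x c : ℝ) : ENNReal :=
  ⨆ C ∈ {C : ℝ → Ω → ℝ | IsAdmissible μ p cbar W U x c C}, strategyValue μ p q W U x C

/-- The optimal value function `V(x,c)`, the supremum of `J(x; C)` over `C ∈ Π_{x,c,cbar}`. It is
real-valued, because the supremum is finite: see `optimalValueENNReal_le`. -/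
def optimalValue {Ω : Type*} [MeasurableSpace Ω] (μ : Measure Ω) (p q cbar : ℝ)
    (W U : ℕ → Ω → ℝ) (x c : ℝ) : ℝ :=
  (optimalValueENNReal μ p q cbar W U x c).toReal

/-- The optimal value is at most `cbar / q`; in particular it is finite. -/
theorem optimalValueENNReal_le {Ω : Type*} [MeasurableSpace Ω] (μ : Measure Ω)
    [IsProbabilityMeasure μ] (p q cbar : ℝ) (hq : 0 < q) (hcbar : 0 ≤ cbar) (W U : ℕ → Ω → ℝ)
    (x c : ℝ) : optimalValueENNReal μ p q cbar W U x c ≤ ENNReal.ofReal (cbar / q) := by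
  refine iSup₂_le fun C hC => ?_
  have hC' : IsAdmissible μ p cbar W U x c C := hC
  have key : ∀ ω, (∫⁻ s in {s : ℝ | 0 ≤ s ∧ (s : EReal) < ruinTime x p W U C ω},
      ENNReal.ofReal (Real.exp (-q * s) * C s ω)) ≤ ENNReal.ofReal (cbar / q) := by
    intro ω
    calc _ ≤ ∫⁻ s in {s : ℝ | 0 ≤ s ∧ (s : EReal) < ruinTime x p W U C ω},
          ENNReal.ofReal (Real.exp (-q * s) * cbar) := by
          refine setLIntegral_mono (by fun_prop) fun s hs => ?_
          exact ENNReal.ofReal_le_ofReal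
            (mul_le_mul_of_nonneg_left (hC'.mem_Icc ω s hs.1).2 (Real.exp_pos _).le)
      _ ≤ ∫⁻ s in Set.Ici (0 : ℝ), ENNReal.ofReal (Real.exp (-q * s) * cbar) :=
          lintegral_mono_set fun s hs => hs.1
      _ = ∫⁻ s in Set.Ioi (0 : ℝ), ENNReal.ofReal (Real.exp (-q * s) * cbar) :=
          setLIntegral_congr Ioi_ae_eq_Ici.symm
      _ = ENNReal.ofReal (∫ s in Set.Ioi (0 : ℝ), Real.exp (-q * s) * cbar) := by
          rw [ofReal_integral_eq_lintegral_ofReal]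
          · exact (integrableOn_exp_mul_Ioi (neg_lt_zero.mpr hq) 0).mul_const cbar
          · exact ae_of_all _ fun s => mul_nonneg (Real.exp_pos _).le hcbar
      _ = ENNReal.ofReal (cbar / q) := by
          rw [integral_mul_const, integral_exp_mul_Ioi (neg_lt_zero.mpr hq)]
          congr 1
          simp
          field_simp
  calc strategyValue μ p q W U x C ≤ ∫⁻ _, ENNReal.ofReal (cbar / q) ∂μ := lintegral_mono key
    _ = ENNReal.ofReal (cbar / q) := by simp

end

end Ratcheting

/-!
Given an admissible strategy `C` for `(x₂, c₁)`, follow `D = max C c₂` from `x₁`. Since `D ≥ C`,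
the only loss is that ruin may come sooner. At time `t` the two controlled surpluses differ by at
most `x₂ - x₁ + (c₂ - c₁) t`, and both fall at speed at least `c₁ - p > 0`, because dividends are
paid at a rate of at least `c₁`. Hence `D` is ruined at some time `τ ≤ x₁ / (c₁ - p)`, and `C` is
ruined at most `(x₂ - x₁ + (c₂ - c₁) τ) / (c₁ - p)` later; dividends in between are paid at a rate
of at most `cbar`.
-/

namespace Ratcheting

/-- The path of claims at `ω` is regular if the claims are nonnegative and only finitely many of
them arrive in bounded time; this isolates what the pathwise comparison of ruin times needs from
the law of the claims. Finiteness excludes the junk value `0` of `Set.ncard` in `claimCount`. -/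
structure IsRegularPath {Ω : Type*} (W U : ℕ → Ω → ℝ) (ω : Ω) : Prop where
  claim_nonneg : ∀ n, 0 ≤ U n ω
  finite_arrivals : ∀ t, {n : ℕ | arrivalTime W n ω ≤ t}.Finite

section Probability

variable {Ω : Type*} [MeasurableSpace Ω] {μ : Measure Ω}

theorem expMeasure_Ioi {β x : ℝ} (hβ : 0 < β) (hx : 0 ≤ x) :
    expMeasure β (Ioi x) = ENNReal.ofReal (Real.exp (-(β * x))) := by
  have := isProbabilityMeasure_expMeasure hβ
  rw [← ofReal_measureReal, ← compl_Iic, probReal_compl_eq_one_sub measurableSet_Iic, ← cdf_eq_real,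
    cdf_expMeasure_eq hβ, if_pos hx, sub_sub_cancel]

theorem ae_not_summable_of_tsum_measure_eq_top {X : ℕ → Ω → ℝ} (hX : ∀ n, Measurable (X n))
    (hindep : iIndepFun X μ) {ε : ℝ} (hε : 0 < ε)
    (hsum : ∑' n, μ (X n ⁻¹' Ioi ε) = ⊤) : ∀ᵐ ω ∂μ, ¬ Summable fun n => X n ω := by
  have := hindep.isProbabilityMeasure
  have hmeas : ∀ n, MeasurableSet (X n ⁻¹' Ioi ε) := fun n => hX n measurableSet_Ioi
  have hindepSet : iIndepSet (fun n => X n ⁻¹' Ioi ε) μ :=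
    (iIndepSet_iff_meas_biInter hmeas).2 fun s =>
      hindep.measure_inter_preimage_eq_mul s fun _ _ => measurableSet_Ioi
  have hlimsup : ∀ᵐ ω ∂μ, ω ∈ limsup (fun n => X n ⁻¹' Ioi ε) atTop :=
    (prob_compl_eq_zero_iff (MeasurableSet.measurableSet_limsup hmeas)).2
      (measure_limsup_eq_one hmeas hindepSet hsum)
  filter_upwards [hlimsup] with ω hω hsummable
  have hsmall : ∀ᶠ n in atTop, X n ω < ε := hsummable.tendsto_atTop_zero.eventually_lt_const hε
  exact mem_limsup_iff_frequently_mem.1 hω (hsmall.mono fun n hn => hn.not_gt)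

namespace IsCramerLundberg

variable {β : ℝ} {ν : Measure ℝ} {W U : ℕ → Ω → ℝ}

theorem ae_claim_nonneg (h : IsCramerLundberg μ β ν W U) (hν : ν (Iio 0) = 0) :
    ∀ᵐ ω ∂μ, ∀ n, 0 ≤ U n ω := by
  have hν' : ∀ᵐ u ∂ν, 0 ≤ u := (measure_eq_zero_iff_ae_notMem.1 hν).mono fun _ => notMem_Iio.1
  exact ae_all_iff.2 fun n =>
    ae_of_ae_map (h.measurable_claim n).aemeasurable ((h.map_claim n).symm ▸ hν')

theorem measure_interarrival_preimage_Ioi (h : IsCramerLundberg μ β ν W U) (hβ : 0 < β) {x : ℝ}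
    (hx : 0 ≤ x) (n : ℕ) : μ (W n ⁻¹' Ioi x) = ENNReal.ofReal (Real.exp (-(β * x))) := by
  rw [← Measure.map_apply (h.measurable_interarrival n) measurableSet_Ioi, h.map_interarrival,
    expMeasure_Ioi hβ hx]

theorem ae_interarrival_pos (h : IsCramerLundberg μ β ν W U) (hβ : 0 < β) :
    ∀ᵐ ω ∂μ, ∀ n, 0 < W n ω := by
  have := h.indep.isProbabilityMeasure
  refine ae_all_iff.2 fun n => ?_
  have hone : μ (W n ⁻¹' Ioi 0) = 1 := by
    simp [h.measure_interarrival_preimage_Ioi hβ le_rfl]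
  exact (prob_compl_eq_zero_iff (h.measurable_interarrival n measurableSet_Ioi)).2 hone

theorem ae_not_summable_interarrival (h : IsCramerLundberg μ β ν W U) (hβ : 0 < β) :
    ∀ᵐ ω ∂μ, ¬ Summable fun n => W n ω := by
  refine ae_not_summable_of_tsum_measure_eq_top h.measurable_interarrival
    (h.indep.precomp (g := Sum.inl) Sum.inl_injective) one_pos ?_
  simp_rw [h.measure_interarrival_preimage_Ioi hβ zero_le_one]
  exact ENNReal.tsum_const_eq_top_of_ne_zero (ENNReal.ofReal_pos.2 (Real.exp_pos _)).ne'

theorem ae_isRegularPath (h : IsCramerLundberg μ β ν W U) (hβ : 0 < β) (hν : ν (Iio 0) = 0) :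
    ∀ᵐ ω ∂μ, IsRegularPath W U ω := by
  filter_upwards [h.ae_claim_nonneg hν, h.ae_interarrival_pos hβ,
    h.ae_not_summable_interarrival hβ] with ω hU hW hsum
  refine ⟨hU, fun t => ?_⟩
  have harrival : Tendsto (fun n => arrivalTime W n ω) atTop atTop :=
    ((not_summable_iff_tendsto_nat_atTop_of_nonneg fun n => (hW n).le).1 hsum).comp
      (tendsto_add_atTop_nat 1)
  have hlate := harrival.eventually_gt_atTop t
  rw [← Nat.cofinite_eq_atTop] at hlate
  simpa only [not_lt] using eventually_cofinite.1 hlate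

end IsCramerLundberg

end Probability

section Path

variable {Ω : Type*} {W U : ℕ → Ω → ℝ} {ω : Ω} {x x₁ x₂ p c d : ℝ} {C D : ℝ → Ω → ℝ}

theorem surplus_eq_add (x y p : ℝ) (W U : ℕ → Ω → ℝ) (t : ℝ) (ω : Ω) :
    surplus y p W U t ω = surplus x p W U t ω + (y - x) := by
  simp only [surplus]
  ring

theorem IsRegularPath.surplus_zero_le (h : IsRegularPath W U ω) (x p : ℝ) :
    surplus x p W U 0 ω ≤ x := by
  have hclaims : 0 ≤ ∑ i ∈ Finset.range (claimCount W 0 ω), U i ω :=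
    Finset.sum_nonneg fun i _ => h.claim_nonneg i
  simp only [surplus]
  linarith

theorem IsRegularPath.surplus_le_add (h : IsRegularPath W U ω) (x p : ℝ) {s t : ℝ} (hst : s ≤ t) :
    surplus x p W U t ω ≤ surplus x p W U s ω + p * (t - s) := by
  have hcount : claimCount W s ω ≤ claimCount W t ω :=
    ncard_le_ncard (fun _ hn => le_trans hn hst) (h.finite_arrivals t)
  have hclaims : ∑ i ∈ Finset.range (claimCount W s ω), U i ω ≤
      ∑ i ∈ Finset.range (claimCount W t ω), U i ω :=
    Finset.sum_le_sum_of_subset_of_nonneg (Finset.range_mono hcount) fun i _ _ => h.claim_nonneg i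
  simp only [surplus]
  linarith

theorem IsRegularPath.controlledSurplus_le_sub (h : IsRegularPath W U ω) (x p : ℝ)
    (hC : ∀ t, 0 ≤ t → IntervalIntegrable (fun s => C s ω) volume 0 t)
    (hcC : ∀ t, 0 ≤ t → c ≤ C t ω) {s t : ℝ} (hs : 0 ≤ s) (hst : s ≤ t) :
    controlledSurplus x p W U C t ω ≤ controlledSurplus x p W U C s ω - (c - p) * (t - s) := by
  have hCst : IntervalIntegrable (fun r => C r ω) volume s t :=
    (hC s hs).symm.trans (hC t (hs.trans hst))
  have hpaid : (t - s) * c ≤ ∫ r in s..t, C r ω := by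
    simpa only [intervalIntegral.integral_const, smul_eq_mul] using
      intervalIntegral.integral_mono_on hst intervalIntegrable_const hCst
        fun r hr => hcC r (hs.trans hr.1)
  have hsplit := intervalIntegral.integral_add_adjacent_intervals (hC s hs) hCst
  have hsurplus := h.surplus_le_add x p hst
  simp only [controlledSurplus]
  linarith

theorem IsRegularPath.controlledSurplus_le (h : IsRegularPath W U ω) (x p : ℝ)
    (hC : ∀ t, 0 ≤ t → IntervalIntegrable (fun s => C s ω) volume 0 t)
    (hcC : ∀ t, 0 ≤ t → c ≤ C t ω) {t : ℝ} (ht : 0 ≤ t) :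
    controlledSurplus x p W U C t ω ≤ x - (c - p) * t := by
  have hinitial : controlledSurplus x p W U C 0 ω ≤ x := by
    simpa only [controlledSurplus, intervalIntegral.integral_same, sub_zero] using
      h.surplus_zero_le x p
  linarith [h.controlledSurplus_le_sub x p hC hcC le_rfl ht]

theorem controlledSurplus_le_add (x₁ x₂ p : ℝ) (W U : ℕ → Ω → ℝ) {t : ℝ} (ht : 0 ≤ t)
    (hC : IntervalIntegrable (fun s => C s ω) volume 0 t)
    (hD : IntervalIntegrable (fun s => D s ω) volume 0 t)
    (hDC : ∀ s, 0 ≤ s → D s ω ≤ C s ω + d) :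
    controlledSurplus x₂ p W U C t ω ≤
      controlledSurplus x₁ p W U D t ω + (x₂ - x₁) + d * t := by
  have hpaid : ∫ s in 0..t, D s ω ≤ (∫ s in 0..t, C s ω) + d * t := by
    calc ∫ s in 0..t, D s ω ≤ ∫ s in 0..t, (C s ω + d) :=
          intervalIntegral.integral_mono_on ht hD (hC.add intervalIntegrable_const)
            fun s hs => hDC s hs.1
      _ = (∫ s in 0..t, C s ω) + d * t := by
          rw [intervalIntegral.integral_add hC intervalIntegrable_const,
            intervalIntegral.integral_const, sub_zero, smul_eq_mul, mul_comm]
  simp only [controlledSurplus, surplus_eq_add x₁ x₂]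
  linarith

theorem le_ruinTime_iff {a : EReal} :
    a ≤ ruinTime x p W U C ω ↔ ∀ t : ℝ, 0 ≤ t → controlledSurplus x p W U C t ω < 0 → a ≤ t := by
  simp only [ruinTime, le_sInf_iff, forall_mem_image, mem_ofPred_eq, and_imp]

theorem ruinTime_le {t : ℝ} (ht : 0 ≤ t) (hneg : controlledSurplus x p W U C t ω < 0) :
    ruinTime x p W U C ω ≤ t :=
  le_ruinTime_iff.1 le_rfl t ht hneg

theorem ruinTime_nonneg : 0 ≤ ruinTime x p W U C ω :=
  le_ruinTime_iff.2 fun _ ht _ => EReal.coe_nonneg.2 ht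

theorem ruinTime_mono (hx : x₁ ≤ x₂) : ruinTime x₁ p W U C ω ≤ ruinTime x₂ p W U C ω := by
  refine le_ruinTime_iff.2 fun t ht hneg => ruinTime_le ht (lt_of_le_of_lt ?_ hneg)
  simp only [controlledSurplus, surplus_eq_add x₁ x₂]
  linarith

theorem IsRegularPath.ruinTime_le_div (h : IsRegularPath W U ω) (hx : 0 ≤ x) (hpc : p < c)
    (hC : ∀ t, 0 ≤ t → IntervalIntegrable (fun s => C s ω) volume 0 t)
    (hcC : ∀ t, 0 ≤ t → c ≤ C t ω) : ruinTime x p W U C ω ≤ ↑(x / (c - p)) := by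
  have hdrift : 0 < c - p := sub_pos.2 hpc
  refine EReal.le_of_forall_lt_iff_le.1 fun t ht => ?_
  have ht' : x / (c - p) < t := EReal.coe_lt_coe_iff.1 ht
  have ht₀ : 0 ≤ t := (div_nonneg hx hdrift.le).trans ht'.le
  refine ruinTime_le ht₀ ((h.controlledSurplus_le x p hC hcC ht₀).trans_lt ?_)
  rw [div_lt_iff₀ hdrift] at ht'
  linarith

theorem IsRegularPath.exists_ruinTime_eq_coe (h : IsRegularPath W U ω) (hx : 0 ≤ x) (hpc : p < c)
    (hC : ∀ t, 0 ≤ t → IntervalIntegrable (fun s => C s ω) volume 0 t)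
    (hcC : ∀ t, 0 ≤ t → c ≤ C t ω) :
    ∃ τ : ℝ, ruinTime x p W U C ω = τ ∧ τ ≤ x / (c - p) := by
  have hle := h.ruinTime_le_div hx hpc hC hcC
  lift ruinTime x p W U C ω to ℝ using
    ⟨ne_top_of_le_ne_top (EReal.coe_ne_top _) hle,
      ne_bot_of_le_ne_bot EReal.zero_ne_bot ruinTime_nonneg⟩ with τ
  exact ⟨τ, rfl, EReal.coe_le_coe_iff.1 hle⟩

theorem IsRegularPath.ruinTime_le_of_neg (h : IsRegularPath W U ω) (hx : x₁ ≤ x₂) (hpc : p < c)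
    (hd : 0 ≤ d) (hC : ∀ t, 0 ≤ t → IntervalIntegrable (fun s => C s ω) volume 0 t)
    (hD : ∀ t, 0 ≤ t → IntervalIntegrable (fun s => D s ω) volume 0 t)
    (hcC : ∀ t, 0 ≤ t → c ≤ C t ω) (hDC : ∀ t, 0 ≤ t → D t ω ≤ C t ω + d) {t : ℝ} (ht : 0 ≤ t)
    (hneg : controlledSurplus x₁ p W U D t ω < 0) :
    ruinTime x₂ p W U C ω ≤ ↑(t + (x₂ - x₁ + d * t) / (c - p)) := by
  have hdrift : 0 < c - p := sub_pos.2 hpc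
  have hdelay : 0 ≤ (x₂ - x₁ + d * t) / (c - p) :=
    div_nonneg (add_nonneg (sub_nonneg.2 hx) (mul_nonneg hd ht)) hdrift.le
  refine ruinTime_le (add_nonneg ht hdelay) ?_
  have hfall := h.controlledSurplus_le_sub x₂ p hC hcC ht (le_add_of_nonneg_right hdelay)
  rw [add_sub_cancel_left, mul_div_cancel₀ _ hdrift.ne'] at hfall
  linarith [controlledSurplus_le_add x₁ x₂ p W U ht (hC t ht) (hD t ht) hDC]

theorem IsRegularPath.ruinTime_le_add (h : IsRegularPath W U ω) (hx₁ : 0 ≤ x₁) (hx : x₁ ≤ x₂)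
    (hpc : p < c) (hd : 0 ≤ d) (hC : ∀ t, 0 ≤ t → IntervalIntegrable (fun s => C s ω) volume 0 t)
    (hD : ∀ t, 0 ≤ t → IntervalIntegrable (fun s => D s ω) volume 0 t)
    (hcC : ∀ t, 0 ≤ t → c ≤ C t ω) (hcD : ∀ t, 0 ≤ t → c ≤ D t ω)
    (hDC : ∀ t, 0 ≤ t → D t ω ≤ C t ω + d) :
    ruinTime x₂ p W U C ω ≤
      ruinTime x₁ p W U D ω + ↑((x₂ - x₁) / (c - p) + x₁ / (c - p) ^ 2 * d) := by
  have hdrift : 0 < c - p := sub_pos.2 hpc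
  obtain ⟨σ, hσ, -⟩ := h.exists_ruinTime_eq_coe (hx₁.trans hx) hpc hC hcC
  obtain ⟨τ, hτ, hτle⟩ := h.exists_ruinTime_eq_coe hx₁ hpc hD hcD
  -- The bound on `σ` at each time of negative surplus is affine in that time, hence inherited by
  -- the infimum `τ`.
  have hστ : (σ * (c - p) - (x₂ - x₁)) / (c - p + d) ≤ τ := by
    rw [← EReal.coe_le_coe_iff, ← hτ, le_ruinTime_iff]
    intro t ht hneg
    have hσt : σ ≤ t + (x₂ - x₁ + d * t) / (c - p) := by
      exact_mod_cast hσ ▸ h.ruinTime_le_of_neg hx hpc hd hC hD hcC hDC ht hneg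
    rw [EReal.coe_le_coe_iff, div_le_iff₀ (by linarith)]
    rw [← sub_le_iff_le_add', le_div_iff₀ hdrift] at hσt
    linarith
  rw [hσ, hτ, ← EReal.coe_add, EReal.coe_le_coe_iff]
  rw [div_le_iff₀ (by linarith)] at hστ
  calc σ ≤ τ + ((x₂ - x₁) / (c - p) + τ / (c - p) * d) := by
        rw [← mul_le_mul_iff_of_pos_right hdrift]
        field_simp
        linarith
    _ ≤ τ + ((x₂ - x₁) / (c - p) + x₁ / (c - p) / (c - p) * d) := by gcongr
    _ = τ + ((x₂ - x₁) / (c - p) + x₁ / (c - p) ^ 2 * d) := by rw [div_div, ← sq]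

end Path

section Dividends

/-- The dividends paid at rate `r` from time `0` until `τ`, discounted at rate `q`. As in
`strategyValue`, the integral takes values in `[0, ∞]`, and a negative rate counts as `0`. -/
noncomputable def discountedDividends (q : ℝ) (r : ℝ → ℝ) (τ : EReal) : ENNReal :=
  ∫⁻ s in {s : ℝ | 0 ≤ s ∧ (s : EReal) < τ}, ENNReal.ofReal (Real.exp (-q * s) * r s)

variable {q M l : ℝ} {r r' : ℝ → ℝ} {σ τ : EReal}

theorem discountedDividends_mono (q : ℝ) (r : ℝ → ℝ) (h : σ ≤ τ) :
    discountedDividends q r σ ≤ discountedDividends q r τ :=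
  lintegral_mono_set fun _ hs => ⟨hs.1, hs.2.trans_le h⟩

theorem discountedDividends_zero (q : ℝ) (r : ℝ → ℝ) : discountedDividends q r 0 = 0 := by
  have hempty : {s : ℝ | 0 ≤ s ∧ (s : EReal) < 0} = ∅ :=
    eq_empty_of_forall_notMem fun s hs => (EReal.coe_nonneg.2 hs.1).not_gt hs.2
  rw [discountedDividends, hempty, Measure.restrict_empty, lintegral_zero_measure]

theorem measurableSet_nonneg_and_coe_lt (τ : EReal) :
    MeasurableSet {s : ℝ | 0 ≤ s ∧ (s : EReal) < τ} :=
  measurableSet_Ici.inter (measurable_coe_real_ereal measurableSet_Iio)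

theorem volume_setOf_coe_mem_Ico_add_le (τ : EReal) (l : ℝ) :
    volume {s : ℝ | (s : EReal) ∈ Ico τ (τ + l)} ≤ ENNReal.ofReal l := by
  induction τ with
  | bot => simp
  | top => simp
  | coe a =>
    have hIco : {s : ℝ | (s : EReal) ∈ Ico (a : EReal) (a + l)} = Ico a (a + l) := by
      ext s
      simp only [mem_ofPred_eq, mem_Ico, ← EReal.coe_add, EReal.coe_le_coe_iff,
        EReal.coe_lt_coe_iff]
    rw [hIco, Real.volume_Ico, add_sub_cancel_left]

theorem ofReal_exp_mul_le {s : ℝ} (hq : 0 ≤ q) (hM : 0 ≤ M) (hs : 0 ≤ s) (hr : r s ≤ M) :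
    ENNReal.ofReal (Real.exp (-q * s) * r s) ≤ ENNReal.ofReal M := by
  refine ENNReal.ofReal_le_ofReal ?_
  have hexp : Real.exp (-q * s) ≤ 1 :=
    Real.exp_le_one_iff.2 (mul_nonpos_of_nonpos_of_nonneg (neg_nonpos.2 hq) hs)
  calc Real.exp (-q * s) * r s ≤ Real.exp (-q * s) * M := by gcongr
    _ ≤ M := mul_le_of_le_one_left hM hexp

theorem discountedDividends_le_add (hq : 0 ≤ q) (hM : 0 ≤ M) (hr : ∀ t, 0 ≤ t → r t ≤ r' t)
    (hrM : ∀ t, 0 ≤ t → r t ≤ M) (hστ : σ ≤ τ + l) :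
    discountedDividends q r σ ≤ discountedDividends q r' τ + ENNReal.ofReal (M * l) := by
  set S : Set ℝ := {s | 0 ≤ s ∧ (s : EReal) < σ}
  set T : Set ℝ := {s | 0 ≤ s ∧ (s : EReal) < τ}
  have hS : MeasurableSet S := measurableSet_nonneg_and_coe_lt σ
  have hT : MeasurableSet T := measurableSet_nonneg_and_coe_lt τ
  have hdiff : S \ T ⊆ {s : ℝ | (s : EReal) ∈ Ico τ (τ + l)} := fun s hs =>
    ⟨not_lt.1 fun hsτ => hs.2 ⟨hs.1.1, hsτ⟩, hs.1.2.trans_le hστ⟩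
  set f : ℝ → ENNReal := fun s => ENNReal.ofReal (Real.exp (-q * s) * r s)
  calc ∫⁻ s in S, f s ≤ ∫⁻ s in T ∪ S \ T, f s :=
        lintegral_mono_set (union_sdiff_self.symm ▸ subset_union_right)
    _ ≤ (∫⁻ s in T, f s) + ∫⁻ s in S \ T, f s := lintegral_union_le _ _ _
    _ ≤ discountedDividends q r' τ + ∫⁻ _ in S \ T, ENNReal.ofReal M := by
        refine add_le_add (setLIntegral_mono' hT fun s hs => ENNReal.ofReal_le_ofReal ?_)
          (setLIntegral_mono' (hS.diff hT) fun s hs =>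
            ofReal_exp_mul_le hq hM hs.1.1 (hrM s hs.1.1))
        exact mul_le_mul_of_nonneg_left (hr s hs.1) (Real.exp_pos _).le
    _ ≤ discountedDividends q r' τ + ENNReal.ofReal (M * l) := by
        rw [setLIntegral_const, ENNReal.ofReal_mul hM]
        gcongr
        exact (measure_mono hdiff).trans (volume_setOf_coe_mem_Ico_add_le τ l)

theorem discountedDividends_le (hq : 0 ≤ q) (hM : 0 ≤ M) (hrM : ∀ t, 0 ≤ t → r t ≤ M)
    (hτ : τ ≤ l) : discountedDividends q r τ ≤ ENNReal.ofReal (M * l) := by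
  have h := discountedDividends_le_add hq hM (fun _ _ => le_rfl) hrM (hτ.trans_eq (zero_add _).symm)
  rwa [discountedDividends_zero, zero_add] at h

end Dividends

section Admissible

theorem comap_surplus_eq {Ω : Type*} (x y p : ℝ) (W U : ℕ → Ω → ℝ) (t : ℝ) :
    MeasurableSpace.comap (surplus x p W U t) inferInstance =
      MeasurableSpace.comap (surplus y p W U t) inferInstance := by
  have hshift : surplus x p W U t = MeasurableEquiv.addRight (x - y) ∘ surplus y p W U t :=
    funext (surplus_eq_add y x p W U t)
  rw [hshift, ← MeasurableSpace.comap_comp,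
    (MeasurableEquiv.addRight (x - y)).measurableEmbedding.comap_eq]

variable {Ω : Type*} [MeasurableSpace Ω] {μ : Measure Ω} {W U : ℕ → Ω → ℝ} {p cbar : ℝ}

theorem surplusFiltration_eq (μ : Measure Ω) (x y p : ℝ) (W U : ℕ → Ω → ℝ) :
    surplusFiltration μ x p W U = surplusFiltration μ y p W U := by
  ext t : 2
  simp only [surplusFiltration, comap_surplus_eq x y]

namespace IsAdmissible

variable {x b c : ℝ} {C : ℝ → Ω → ℝ}

theorem change_surplus (h : IsAdmissible μ p cbar W U x c C) (y : ℝ) :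
    IsAdmissible μ p cbar W U y c C :=
  { h with adapted := surplusFiltration_eq μ x y p W U ▸ h.adapted }

theorem mono_left (h : IsAdmissible μ p cbar W U x c C) (hbc : b ≤ c) :
    IsAdmissible μ p cbar W U x b C :=
  { h with mem_Icc := fun ω t ht => Icc_subset_Icc_left hbc (h.mem_Icc ω t ht) }

theorem max_const (h : IsAdmissible μ p cbar W U x b C) (hc : c ≤ cbar) :
    IsAdmissible μ p cbar W U x c (fun t ω => max (C t ω) c) where
  adapted t ht := (h.adapted t ht).max measurable_const
  right_continuous ω t ht := (h.right_continuous ω t ht).max continuousWithinAt_const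
  left_limits ω t ht :=
    let ⟨l, hl⟩ := h.left_limits ω t ht
    ⟨max l c, hl.max tendsto_const_nhds⟩
  monotone ω _ hs _ ht hst := max_le_max_right c (h.monotone ω hs ht hst)
  mem_Icc ω t ht := ⟨le_max_right _ _, max_le (h.mem_Icc ω t ht).2 hc⟩

theorem intervalIntegrable (h : IsAdmissible μ p cbar W U x c C) (ω : Ω) {t : ℝ} (ht : 0 ≤ t) :
    IntervalIntegrable (fun s => C s ω) volume 0 t :=
  ((h.monotone ω).mono fun _ hs => (le_min le_rfl ht).trans hs.1).intervalIntegrable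

end IsAdmissible

end Admissible

section Value

variable {Ω : Type*} [MeasurableSpace Ω] {μ : Measure Ω} {W U : ℕ → Ω → ℝ}
  {p q cbar x x₁ x₂ c c₁ c₂ : ℝ}

theorem strategyValue_eq_lintegral_discountedDividends (μ : Measure Ω) (p q : ℝ)
    (W U : ℕ → Ω → ℝ) (x : ℝ) (C : ℝ → Ω → ℝ) :
    strategyValue μ p q W U x C =
      ∫⁻ ω, discountedDividends q (fun s => C s ω) (ruinTime x p W U C ω) ∂μ :=
  rfl

theorem strategyValue_mono (hx : x₁ ≤ x₂) (C : ℝ → Ω → ℝ) :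
    strategyValue μ p q W U x₁ C ≤ strategyValue μ p q W U x₂ C :=
  lintegral_mono fun _ => discountedDividends_mono q _ (ruinTime_mono hx)

theorem optimalValueENNReal_mono (hx : x₁ ≤ x₂) (hc : c₁ ≤ c₂) :
    optimalValueENNReal μ p q cbar W U x₁ c₂ ≤ optimalValueENNReal μ p q cbar W U x₂ c₁ :=
  iSup₂_le fun C hC => (strategyValue_mono hx C).trans <|
    le_iSup₂_of_le C ((IsAdmissible.change_surplus hC x₂).mono_left hc) le_rfl

variable [IsProbabilityMeasure μ]

theorem optimalValueENNReal_le_div (hq : 0 ≤ q) (hcbar : 0 ≤ cbar)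
    (hpath : ∀ᵐ ω ∂μ, IsRegularPath W U ω) (hx : 0 ≤ x) (hpc : p < c) :
    optimalValueENNReal μ p q cbar W U x c ≤ ENNReal.ofReal (cbar * (x / (c - p))) := by
  refine iSup₂_le fun C hC => ?_
  have hC : IsAdmissible μ p cbar W U x c C := hC
  have hdividends : ∀ᵐ ω ∂μ,
      discountedDividends q (fun s => C s ω) (ruinTime x p W U C ω) ≤
        ENNReal.ofReal (cbar * (x / (c - p))) := by
    filter_upwards [hpath] with ω hω
    exact discountedDividends_le hq hcbar (fun t ht => (hC.mem_Icc ω t ht).2)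
      (hω.ruinTime_le_div hx hpc (fun _ => hC.intervalIntegrable ω)
        fun t ht => (hC.mem_Icc ω t ht).1)
  calc strategyValue μ p q W U x C ≤ ∫⁻ _, ENNReal.ofReal (cbar * (x / (c - p))) ∂μ :=
        lintegral_mono_ae hdividends
    _ = ENNReal.ofReal (cbar * (x / (c - p))) := by
        rw [lintegral_const, measure_univ, mul_one]

theorem strategyValue_le_max_const_add (hq : 0 ≤ q) (hcbar : 0 ≤ cbar)
    (hpath : ∀ᵐ ω ∂μ, IsRegularPath W U ω) (hx₁ : 0 ≤ x₁) (hx : x₁ ≤ x₂) (hpc : p < c₁)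
    (hc : c₁ ≤ c₂) (hc₂ : c₂ ≤ cbar) {C : ℝ → Ω → ℝ} (hC : IsAdmissible μ p cbar W U x₂ c₁ C) :
    strategyValue μ p q W U x₂ C ≤
      strategyValue μ p q W U x₁ (fun t ω => max (C t ω) c₂) +
        ENNReal.ofReal (cbar * ((x₂ - x₁) / (c₁ - p) + x₁ / (c₁ - p) ^ 2 * (c₂ - c₁))) := by
  set D : ℝ → Ω → ℝ := fun t ω => max (C t ω) c₂
  set δ : ℝ := (x₂ - x₁) / (c₁ - p) + x₁ / (c₁ - p) ^ 2 * (c₂ - c₁)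
  have hD : IsAdmissible μ p cbar W U x₂ c₂ D := hC.max_const hc₂
  have hruin : ∀ᵐ ω ∂μ, ruinTime x₂ p W U C ω ≤ ruinTime x₁ p W U D ω + δ := by
    filter_upwards [hpath] with ω hω
    have hc₁C : ∀ t, 0 ≤ t → c₁ ≤ C t ω := fun t ht => (hC.mem_Icc ω t ht).1
    exact hω.ruinTime_le_add hx₁ hx hpc (sub_nonneg.2 hc) (fun _ => hC.intervalIntegrable ω)
      (fun _ => hD.intervalIntegrable ω) hc₁C (fun t ht => hc.trans (hD.mem_Icc ω t ht).1)
      fun t ht => max_le (by linarith) (by linarith [hc₁C t ht])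
  have hdividends : ∀ᵐ ω ∂μ,
      discountedDividends q (fun s => C s ω) (ruinTime x₂ p W U C ω) ≤
        discountedDividends q (fun s => D s ω) (ruinTime x₁ p W U D ω) +
          ENNReal.ofReal (cbar * δ) := by
    filter_upwards [hruin] with ω hω
    exact discountedDividends_le_add hq hcbar (fun _ _ => le_max_left _ _)
      (fun t ht => (hC.mem_Icc ω t ht).2) hω
  simp only [strategyValue_eq_lintegral_discountedDividends]
  refine (lintegral_mono_ae hdividends).trans_eq ?_
  rw [lintegral_add_right _ measurable_const, lintegral_const, measure_univ, mul_one]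

theorem optimalValueENNReal_le_add (hq : 0 ≤ q) (hcbar : 0 ≤ cbar)
    (hpath : ∀ᵐ ω ∂μ, IsRegularPath W U ω) (hx₁ : 0 ≤ x₁) (hx : x₁ ≤ x₂) (hpc : p < c₁)
    (hc : c₁ ≤ c₂) (hc₂ : c₂ ≤ cbar) :
    optimalValueENNReal μ p q cbar W U x₂ c₁ ≤ optimalValueENNReal μ p q cbar W U x₁ c₂ +
      ENNReal.ofReal (cbar * ((x₂ - x₁) / (c₁ - p) + x₁ / (c₁ - p) ^ 2 * (c₂ - c₁))) :=
  iSup₂_le fun C hC =>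
    (strategyValue_le_max_const_add hq hcbar hpath hx₁ hx hpc hc hc₂ hC).trans <|
      add_le_add_left (α := ENNReal) (le_iSup₂_of_le (fun t ω => max (C t ω) c₂)
        ((IsAdmissible.max_const hC hc₂).change_surplus x₁) le_rfl) _

end Value

end Ratcheting

open Ratcheting in
theorem mainTheorem8_general {Ω : Type*} [MeasurableSpace Ω] {μ : Measure Ω}
    [IsProbabilityMeasure μ] {W U : ℕ → Ω → ℝ} {p q cbar x₁ x₂ c₁ c₂ : ℝ}
    (hpath : ∀ᵐ ω ∂μ, IsRegularPath W U ω) (hq : 0 ≤ q) (hcbar : 0 ≤ cbar)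
    (hx₁ : 0 ≤ x₁) (hx : x₁ ≤ x₂) (hpc : p < c₁) (hc : c₁ ≤ c₂) (hc₂ : c₂ ≤ cbar) :
    0 ≤ optimalValue μ p q cbar W U x₂ c₁ - optimalValue μ p q cbar W U x₁ c₂ ∧
      optimalValue μ p q cbar W U x₂ c₁ - optimalValue μ p q cbar W U x₁ c₂ ≤
        cbar / (c₁ - p) * (x₂ - x₁) + cbar * x₁ / (c₁ - p) ^ 2 * (c₂ - c₁) := by
  have hfinite {x c : ℝ} (hx : 0 ≤ x) (hpc : p < c) :
      optimalValueENNReal μ p q cbar W U x c ≠ ⊤ :=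
    ne_top_of_le_ne_top ENNReal.ofReal_ne_top
      (optimalValueENNReal_le_div hq hcbar hpath hx hpc)
  have hfinite₁ := hfinite hx₁ (hpc.trans_le hc)
  have hfinite₂ := hfinite (hx₁.trans hx) hpc
  refine ⟨sub_nonneg.2 (ENNReal.toReal_mono hfinite₂ (optimalValueENNReal_mono hx hc)), ?_⟩
  have hdrift : 0 ≤ c₁ - p := (sub_pos.2 hpc).le
  have hloss : 0 ≤ cbar * ((x₂ - x₁) / (c₁ - p) + x₁ / (c₁ - p) ^ 2 * (c₂ - c₁)) :=
    mul_nonneg hcbar (add_nonneg (div_nonneg (sub_nonneg.2 hx) hdrift)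
      (mul_nonneg (div_nonneg hx₁ (sq_nonneg _)) (sub_nonneg.2 hc)))
  have hle := ENNReal.toReal_mono (ENNReal.add_ne_top.2 ⟨hfinite₁, ENNReal.ofReal_ne_top⟩)
    (optimalValueENNReal_le_add hq hcbar hpath hx₁ hx hpc hc hc₂)
  rw [ENNReal.toReal_add hfinite₁ ENNReal.ofReal_ne_top, ENNReal.toReal_ofReal hloss] at hle
  exact (sub_le_iff_le_add'.2 hle).trans_eq (by ring)

theorem mainTheorem8 (p β q cbar : ℝ) (ν : Measure ℝ) [IsProbabilityMeasure ν]
    (hβ : 0 < β) (hq : 0 < q)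
    -- claim sizes are nonnegative and have a finite mean, with safety loading `p > β E[U]`
    (hν_nonneg : ν (Set.Iio 0) = 0) (hν_int : Integrable (fun u : ℝ => u) ν)
    (hp : β * ∫ u, u ∂ν < p)
    -- the claim size distribution function is globally Lipschitz
    (hF : ∃ K : ℝ, 0 < K ∧ ∀ a b : ℝ, a < b → cdf ν b - cdf ν a ≤ K * (b - a))
    (hcbar : p < cbar) :
    ∃ K₂ K₃ : ℝ, 0 < K₂ ∧ 0 < K₃ ∧
      ∀ (Ω : Type*) [MeasurableSpace Ω] (μ : Measure Ω) [IsProbabilityMeasure μ]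
        (W U : ℕ → Ω → ℝ), Ratcheting.IsCramerLundberg μ β ν W U →
        ∀ x₁ x₂ c₁ c₂ : ℝ, 0 ≤ x₁ → x₁ ≤ x₂ → p < c₁ → c₁ ≤ c₂ → c₂ ≤ cbar →
          0 ≤ Ratcheting.optimalValue μ p q cbar W U x₂ c₁
              - Ratcheting.optimalValue μ p q cbar W U x₁ c₂ ∧
          Ratcheting.optimalValue μ p q cbar W U x₂ c₁
              - Ratcheting.optimalValue μ p q cbar W U x₁ c₂
            ≤ (K₂ + K₃ / (c₁ - p)) * (x₂ - x₁)
              + (K₂ + K₃ * x₂ / (c₁ - p) ^ 2) * (c₂ - c₁) := by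
  have hmean : 0 ≤ ∫ u, u ∂ν :=
    integral_nonneg_of_ae ((measure_eq_zero_iff_ae_notMem.1 hν_nonneg).mono fun _ => notMem_Iio.1)
  have hcbar_pos : 0 < cbar := ((mul_nonneg hβ.le hmean).trans_lt hp).trans hcbar
  refine ⟨1, cbar, one_pos, hcbar_pos, fun Ω _ μ _ W U hCL x₁ x₂ c₁ c₂ hx₁ hx hpc hc hc₂ =>
    (mainTheorem8_general (hCL.ae_isRegularPath hβ hν_nonneg) hq.le hcbar_pos.le
      hx₁ hx hpc hc hc₂).imp_right fun hle => hle.trans ?_⟩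
  gcongr ?_ * _ + ?_ * _
  · exact le_add_of_nonneg_left zero_le_one
  · exact le_add_of_nonneg_of_le zero_le_one (by gcongr)
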